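/- Let $n\ge 1$, let $x_0<x_1<\dots<x_n$ be real knots, put $h:=\max_{1\le i\le n}(x_i-x_{i-1})$, let $f\in C^4([x_0,x_n])$ be real-valued, and put $\|f^{(4)}\|_\infty:=\max_{\xi\in[x_0,x_n]}|f^{(4)}(\xi)|$. Let $R$ be a real constant and let $\kappa_0,\kappa_n\in\mathbb{R}$ satisfy $|\kappa_0-f''(x_0)|\le R\,\|f^{(4)}\|_\infty h^2$ and $|\kappa_n-f''(x_n)|\le R\,\|f^{(4)}\|_\infty h^2$. Let $s$ be the cubic spline interpolating $f$ at the knots with end conditions $s''(x_0)=\kappa_0$ and $s''(x_n)=\kappa_n$ (an $R$-approximate clamped natural spline); that is, $s\in C^2([x_0,x_n])$, $s$ coincides with a polynomial of degree at most $3$ on each $[x_{i-1},x_i]$ $(1\le i\le n)$, and $s(x_i)=f(x_i)$ for $0\le i\le n$. Then, for all $x\in[x_0,x_n]$, $$|s(x)-f(x)|\le\left(\tfrac{5}{384}+\tfrac{R}{8}\right)\|f^{(4)}\|_\infty h^4 .$$ Derivatives at the end points $x_0$ and $x_n$ are one-sided. -/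

import Mathlib

open Set

noncomputable section

/-- The interval `[x₀, xₙ]` spanned by the knots `x₀, …, xₙ`. -/
def knotInterval {n : ℕ} (x : Fin (n + 1) → ℝ) : Set ℝ :=
  Icc (x 0) (x (Fin.last n))

/-- The mesh size `h = max_{1 ≤ i ≤ n} (x_i - x_{i-1})`. -/
def meshSize {n : ℕ} (x : Fin (n + 1) → ℝ) : ℝ :=
  ⨆ i : Fin n, (x i.succ - x i.castSucc)

/-- The value at `t` of the second derivative of `g`, regarded as a function on `[x₀, xₙ]`
(one-sided at the end points). -/
def secondDeriv {n : ℕ} (x : Fin (n + 1) → ℝ) (g : ℝ → ℝ) (t : ℝ) : ℝ :=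
  iteratedDerivWithin 2 g (knotInterval x) t

/-- `‖f⁽⁴⁾‖_∞`, the maximum of `|f⁽⁴⁾|` over `[x₀, xₙ]` (one-sided derivatives at the end
points). For `f` of class `C⁴` on `[x₀, xₙ]` the supremum is attained. -/
def fourthDerivNorm {n : ℕ} (x : Fin (n + 1) → ℝ) (f : ℝ → ℝ) : ℝ :=
  sSup ((fun ξ => |iteratedDerivWithin 4 f (knotInterval x) ξ|) '' knotInterval x)

/-- `s` is a cubic spline interpolating `f` at the knots `x₀, …, xₙ`: it is of class `C²` on
`[x₀, xₙ]`, it agrees with a polynomial of degree at most three on each `[x_{i-1}, x_i]`, and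
`s(x_i) = f(x_i)` for all `i`. -/
structure IsCubicSplineInterpolant {n : ℕ} (x : Fin (n + 1) → ℝ) (f s : ℝ → ℝ) : Prop where
  contDiffOn : ContDiffOn ℝ 2 s (knotInterval x)
  piecewise_cubic : ∀ i : Fin n, ∃ p : Polynomial ℝ, p.degree ≤ 3 ∧
    ∀ t ∈ Icc (x i.castSucc) (x i.succ), s t = p.eval t
  interpolates : ∀ i : Fin (n + 1), s (x i) = f (x i)

/-- `s` is an `R`-approximate clamped natural spline for `f` on the knots `x₀, …, xₙ`: the cubic
spline interpolant of `f` with end conditions `s''(x₀) = κ₀`, `s''(xₙ) = κₙ`, for some numbers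
`κ₀, κₙ` that differ from `f''(x₀)` and `f''(xₙ)` by at most `R ‖f⁽⁴⁾‖_∞ h²`. -/
def IsApproxClampedNaturalSpline {n : ℕ} (R : ℝ) (x : Fin (n + 1) → ℝ) (f s : ℝ → ℝ) : Prop :=
  ∃ κ₀ κₙ : ℝ,
    |κ₀ - secondDeriv x f (x 0)| ≤ R * fourthDerivNorm x f * meshSize x ^ 2 ∧
    |κₙ - secondDeriv x f (x (Fin.last n))| ≤ R * fourthDerivNorm x f * meshSize x ^ 2 ∧
    IsCubicSplineInterpolant x f s ∧
    secondDeriv x s (x 0) = κ₀ ∧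
    secondDeriv x s (x (Fin.last n)) = κₙ

end

/-! On each subinterval the error `s - f` vanishes at both ends, and its fourth derivative is
`-f⁽⁴⁾`. Comparison with Hermite quartics gives `|s - f| ≤ M h⁴/384 + D h/4`, where `D` bounds the
slope error at the knots (`IsDerivChain.abs_le`), and ties the error's curvature at each end to its
two end slopes (`second_deriv_left`, `second_deriv_right`). At the knot with largest slope error,
continuity of `s''` eliminates the curvature, or the end condition bounds it. The resulting relation
is diagonally dominant, so `D = M h³/24 + R M h³/2` (`slope_error`). Finally `1/384 + 1/96 = 5/384`
and `(R/2)/4 = R/8`. -/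

/-- `g 0, …, g 4` are successive derivatives of each other on `[p, q]`. -/
def IsDerivChain (p q : ℝ) (g : ℕ → ℝ → ℝ) : Prop :=
  ∀ k < 4, ∀ u ∈ Icc p q, HasDerivWithinAt (g k) (g (k + 1) u) (Icc p q) u

/-- The successive derivatives of `b (u-p) + c (u-p)² + d (u-p)³ + e (u-p)⁴`. -/
def quarticChain (p b c d e : ℝ) : ℕ → ℝ → ℝ
  | 0, u => b * (u - p) + c * (u - p) ^ 2 + d * (u - p) ^ 3 + e * (u - p) ^ 4
  | 1, u => b + 2 * c * (u - p) + 3 * d * (u - p) ^ 2 + 4 * e * (u - p) ^ 3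
  | 2, u => 2 * c + 6 * d * (u - p) + 12 * e * (u - p) ^ 2
  | 3, u => 6 * d + 24 * e * (u - p)
  | _, _ => 24 * e

theorem isDerivChain_quarticChain (p q r b c d e : ℝ) :
    IsDerivChain p q (quarticChain r b c d e) := by
  intro k hk u _
  have h1 : HasDerivAt (fun u : ℝ => u - r) 1 u := (hasDerivAt_id u).sub_const r
  have h2 := h1.pow 2
  have h3 := h1.pow 3
  have h4 := h1.pow 4
  apply HasDerivAt.hasDerivWithinAt
  interval_cases k
  · exact ((((h1.const_mul b).add (h2.const_mul c)).add (h3.const_mul d)).add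
      (h4.const_mul e)).congr_deriv (by simp [quarticChain]; ring)
  · exact (((((hasDerivAt_const u b).add (h1.const_mul (2 * c)))).add
      (h2.const_mul (3 * d))).add (h3.const_mul (4 * e))).congr_deriv
      (by simp [quarticChain]; ring)
  · exact (((hasDerivAt_const u (2 * c)).add (h1.const_mul (6 * d))).add
      (h2.const_mul (12 * e))).congr_deriv (by simp [quarticChain]; ring)
  · exact ((hasDerivAt_const u (6 * d)).add (h1.const_mul (24 * e))).congr_deriv
      (by simp [quarticChain])

theorem IsDerivChain.sub {p q : ℝ} {g g' : ℕ → ℝ → ℝ} (h : IsDerivChain p q g)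
    (h' : IsDerivChain p q g') : IsDerivChain p q (fun k u => g k u - g' k u) :=
  fun k hk u hu => (h k hk u hu).sub (h' k hk u hu)

theorem IsDerivChain.rolle {p q : ℝ} {g : ℕ → ℝ → ℝ} (h : IsDerivChain p q g) {k : ℕ}
    (hk : k < 4) {a b : ℝ} (ha : p ≤ a) (hab : a < b) (hb : b ≤ q) (ga : g k a = 0)
    (gb : g k b = 0) : ∃ c, a < c ∧ c < b ∧ g (k + 1) c = 0 := by
  have hsub : Icc a b ⊆ Icc p q := Icc_subset_Icc ha hb
  obtain ⟨c, hc, hc0⟩ := exists_hasDerivAt_eq_zero (f := g k) (f' := g (k + 1)) hab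
    (fun u hu => ((h k hk u (hsub hu)).mono hsub).continuousWithinAt) (ga.trans gb.symm)
    (fun u hu => (h k hk u (hsub (Ioo_subset_Icc_self hu))).hasDerivAt
      (Icc_mem_nhds (ha.trans_lt hu.1) (hu.2.trans_le hb)))
  exact ⟨c, hc.1, hc.2, hc0⟩

theorem IsDerivChain.exists_fourth_eq_zero {p q : ℝ} {g : ℕ → ℝ → ℝ} (h : IsDerivChain p q g)
    {a b c : ℝ} (ha : p ≤ a) (hab : a < b) (hbc : b < c) (hc : c ≤ q) (ga : g 2 a = 0)
    (gb : g 2 b = 0) (gc : g 2 c = 0) : ∃ u ∈ Icc p q, g 4 u = 0 := by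
  obtain ⟨v, hv1, hv2, hv⟩ := h.rolle (k := 2) (by norm_num) ha hab (hbc.le.trans hc) ga gb
  obtain ⟨w, hw1, hw2, hw⟩ := h.rolle (k := 2) (by norm_num) (ha.trans hab.le) hbc hc gb gc
  obtain ⟨z, hz1, hz2, hz⟩ := h.rolle (k := 3) (by norm_num) (by linarith) (hv2.trans hw1)
    (by linarith) hv hw
  exact ⟨z, ⟨by linarith, by linarith⟩, hz⟩

/-- The quartics having value `0` and slopes `A`, `B` at the end points of `[p, q]`, and their
derivatives; `C` is the leading coefficient. -/
noncomputable def hermiteChain (p q A B C : ℝ) : ℕ → ℝ → ℝ :=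
  quarticChain p A (-(2 * A + B) / (q - p) + C * (q - p) ^ 2)
    ((A + B) / (q - p) ^ 2 - 2 * (q - p) * C) C

/-! ### Hermite comparison on one subinterval -/

section Interval

variable {p q M : ℝ} {g : ℕ → ℝ → ℝ}

theorem hermite_coeff_bound (hM : ∀ u ∈ Icc p q, |g 4 u| ≤ M) {A B C : ℝ}
    (h : ∃ u ∈ Icc p q, g 4 u - hermiteChain p q A B C 4 u = 0) : |C| ≤ M / 24 := by
  obtain ⟨u, hu, h0⟩ := h
  have := hM u hu
  have h1 : g 4 u = 24 * C := by simpa [hermiteChain, quarticChain, sub_eq_zero] using h0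
  rw [h1, abs_mul, abs_of_pos (by norm_num : (0 : ℝ) < 24)] at this
  linarith

theorem hermite_residual_ends (hpq : p < q) (gp : g 0 p = 0) (gq : g 0 q = 0) (C : ℝ) :
    let r := fun k u => g k u - hermiteChain p q (g 1 p) (g 1 q) C k u
    r 0 p = 0 ∧ r 0 q = 0 ∧ r 1 p = 0 ∧ r 1 q = 0 := by
  have : q - p ≠ 0 := (sub_pos.2 hpq).ne'
  refine ⟨?_, ?_, ?_, ?_⟩ <;> simp only [hermiteChain, quarticChain, gp, gq] <;> field_simp <;>
    ring

/-- For the Hermite cubic the left side is zero; adding `C (u-p)²(u-q)²` changes it by `2C(q-p)³`.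
With `C` chosen to match `g''` at `q`, the residual's second derivative has two Rolle zeros besides
`q`, so `24C` is a value of `g⁗`. -/
theorem IsDerivChain.second_deriv_right (h : IsDerivChain p q g) (hpq : p < q) (gp : g 0 p = 0)
    (gq : g 0 q = 0) (hM : ∀ u ∈ Icc p q, |g 4 u| ≤ M) :
    |g 2 q * (q - p) - (2 * g 1 p + 4 * g 1 q)| ≤ M * (q - p) ^ 3 / 12 := by
  have ha : 0 < q - p := sub_pos.2 hpq
  set C := (g 2 q * (q - p) - (2 * g 1 p + 4 * g 1 q)) / (2 * (q - p) ^ 3) with hC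
  obtain ⟨r1, r2, r3, r4⟩ := hermite_residual_ends hpq gp gq C
  have hr := h.sub (isDerivChain_quarticChain p q p (g 1 p)
    (-(2 * g 1 p + g 1 q) / (q - p) + C * (q - p) ^ 2)
    ((g 1 p + g 1 q) / (q - p) ^ 2 - 2 * (q - p) * C) C)
  obtain ⟨η, h1, h2, hη⟩ := hr.rolle (k := 0) (by norm_num) le_rfl hpq le_rfl r1 r2
  obtain ⟨v, hv1, hv2, hv⟩ := hr.rolle (k := 1) (by norm_num) le_rfl h1 h2.le r3 hη
  obtain ⟨w, hw1, hw2, hw⟩ := hr.rolle (k := 1) (by norm_num) h1.le h2 le_rfl hη r4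
  have hb := hermite_coeff_bound hM (hr.exists_fourth_eq_zero hv1.le (hv2.trans hw1) hw2 le_rfl
    hv hw (by simp only [quarticChain, hC]; field_simp; ring))
  have : g 2 q * (q - p) - (2 * g 1 p + 4 * g 1 q) = C * (2 * (q - p) ^ 3) := by
    rw [hC]; field_simp
  rw [this, abs_mul, abs_of_pos (by positivity : 0 < 2 * (q - p) ^ 3)]
  nlinarith [mul_le_mul_of_nonneg_right hb (by positivity : 0 ≤ 2 * (q - p) ^ 3)]

theorem IsDerivChain.second_deriv_left (h : IsDerivChain p q g) (hpq : p < q) (gp : g 0 p = 0)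
    (gq : g 0 q = 0) (hM : ∀ u ∈ Icc p q, |g 4 u| ≤ M) :
    |g 2 p * (q - p) + (4 * g 1 p + 2 * g 1 q)| ≤ M * (q - p) ^ 3 / 12 := by
  have ha : 0 < q - p := sub_pos.2 hpq
  set C := (g 2 p * (q - p) + (4 * g 1 p + 2 * g 1 q)) / (2 * (q - p) ^ 3) with hC
  obtain ⟨r1, r2, r3, r4⟩ := hermite_residual_ends hpq gp gq C
  have hr := h.sub (isDerivChain_quarticChain p q p (g 1 p)
    (-(2 * g 1 p + g 1 q) / (q - p) + C * (q - p) ^ 2)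
    ((g 1 p + g 1 q) / (q - p) ^ 2 - 2 * (q - p) * C) C)
  obtain ⟨η, h1, h2, hη⟩ := hr.rolle (k := 0) (by norm_num) le_rfl hpq le_rfl r1 r2
  obtain ⟨v, hv1, hv2, hv⟩ := hr.rolle (k := 1) (by norm_num) le_rfl h1 h2.le r3 hη
  obtain ⟨w, hw1, hw2, hw⟩ := hr.rolle (k := 1) (by norm_num) h1.le h2 le_rfl hη r4
  have hb := hermite_coeff_bound hM (hr.exists_fourth_eq_zero le_rfl hv1 (hv2.trans hw1) hw2.le
    (by simp only [quarticChain, hC]; field_simp; ring) hv hw)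
  have : g 2 p * (q - p) + (4 * g 1 p + 2 * g 1 q) = C * (2 * (q - p) ^ 3) := by
    rw [hC]; field_simp
  rw [this, abs_mul, abs_of_pos (by positivity : 0 < 2 * (q - p) ^ 3)]
  nlinarith [mul_le_mul_of_nonneg_right hb (by positivity : 0 ≤ 2 * (q - p) ^ 3)]

/-- The Hermite cubic contributes the slope term, and the correction `C (u-p)²(u-q)²` the `M` term.
-/
theorem IsDerivChain.abs_le (h : IsDerivChain p q g) (gp : g 0 p = 0)
    (gq : g 0 q = 0) (hM : ∀ u ∈ Icc p q, |g 4 u| ≤ M) {D : ℝ} (hp : |g 1 p| ≤ D)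
    (hq : |g 1 q| ≤ D) {t : ℝ} (ht : t ∈ Icc p q) :
    |g 0 t| ≤ M * (q - p) ^ 4 / 384 + D * (q - p) / 4 := by
  have hD : 0 ≤ D := (abs_nonneg _).trans hp
  have hM0 : 0 ≤ M := (abs_nonneg _).trans (hM t ht)
  have ha0 : 0 ≤ q - p := sub_nonneg.2 (ht.1.trans ht.2)
  have hpos : 0 ≤ M * (q - p) ^ 4 / 384 + D * (q - p) / 4 := by positivity
  rcases ht.1.eq_or_lt with rfl | htp
  · simpa [gp] using hpos
  rcases ht.2.eq_or_lt with rfl | htq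
  · simpa [gq] using hpos
  have hpq := htp.trans htq
  have ha : 0 < q - p := sub_pos.2 hpq
  have hv : 0 < t - p := sub_pos.2 htp
  have hw : 0 < q - t := sub_pos.2 htq
  set Q := (g 1 p * ((t - p) * (q - t) ^ 2) - g 1 q * ((t - p) ^ 2 * (q - t))) / (q - p) ^ 2
    with hQ
  -- `Q` is the Hermite cubic at `t`; this `C` makes the residual vanish at `t` too, giving its
  -- second derivative three zeros.
  set C := (g 0 t - Q) / ((t - p) ^ 2 * (q - t) ^ 2) with hC
  obtain ⟨r1, r2, r3, r4⟩ := hermite_residual_ends hpq gp gq C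
  have hr := h.sub (isDerivChain_quarticChain p q p (g 1 p)
    (-(2 * g 1 p + g 1 q) / (q - p) + C * (q - p) ^ 2)
    ((g 1 p + g 1 q) / (q - p) ^ 2 - 2 * (q - p) * C) C)
  have key : g 0 t = Q + C * ((t - p) ^ 2 * (q - t) ^ 2) := by
    rw [hC]; field_simp; ring
  have rt : g 0 t - hermiteChain p q (g 1 p) (g 1 q) C 0 t = 0 := by
    rw [key, hQ]
    simp only [hermiteChain, quarticChain]
    field_simp
    ring
  obtain ⟨η, h1, h2, hη⟩ := hr.rolle (k := 0) (by norm_num) le_rfl htp htq.le r1 rt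
  obtain ⟨ζ, h3, h4, hζ⟩ := hr.rolle (k := 0) (by norm_num) htp.le htq le_rfl rt r2
  obtain ⟨v, hv1, hv2, hv'⟩ := hr.rolle (k := 1) (by norm_num) le_rfl h1 (by linarith) r3 hη
  obtain ⟨w, hw1, hw2, hw'⟩ := hr.rolle (k := 1) (by norm_num) h1.le (h2.trans h3) h4.le hη hζ
  obtain ⟨z, hz1, hz2, hz⟩ := hr.rolle (k := 1) (by norm_num) (by linarith) h4 le_rfl hζ r4
  have hb := hermite_coeff_bound hM (hr.exists_fourth_eq_zero hv1.le (hv2.trans hw1)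
    (hw2.trans hz1) hz2.le hv' hw' hz)
  have hprod : (t - p) * (q - t) ≤ (q - p) ^ 2 / 4 := by nlinarith [sq_nonneg ((t - p) - (q - t))]
  have hQb : |Q| ≤ D * (q - p) / 4 := by
    have e1 : |g 1 p * ((t - p) * (q - t) ^ 2) - g 1 q * ((t - p) ^ 2 * (q - t))| ≤
        D * ((t - p) * (q - t) ^ 2) + D * ((t - p) ^ 2 * (q - t)) := by
      refine (abs_sub _ _).trans ?_
      rw [abs_mul, abs_mul (g 1 q), abs_of_pos (by positivity : 0 < (t - p) * (q - t) ^ 2),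
        abs_of_pos (by positivity : 0 < (t - p) ^ 2 * (q - t))]
      gcongr
    rw [hQ, abs_div, abs_of_pos (by positivity : 0 < (q - p) ^ 2), div_le_iff₀ (by positivity)]
    calc _ ≤ _ := e1
      _ = D * (q - p) * ((t - p) * (q - t)) := by ring
      _ ≤ D * (q - p) * ((q - p) ^ 2 / 4) := by gcongr
      _ = _ := by ring
  have hCb : |C * ((t - p) ^ 2 * (q - t) ^ 2)| ≤ M * (q - p) ^ 4 / 384 := by
    rw [abs_mul, abs_of_pos (by positivity : 0 < (t - p) ^ 2 * (q - t) ^ 2)]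
    calc _ ≤ M / 24 * ((t - p) * (q - t)) ^ 2 := by rw [mul_pow]; gcongr
      _ ≤ M / 24 * ((q - p) ^ 2 / 4) ^ 2 := by gcongr
      _ = _ := by ring
  rw [key]
  exact (abs_add_le _ _).trans (by linarith)

end Interval

theorem exists_mem_Icc_castSucc_succ {n : ℕ} (hn : 1 ≤ n) (x : Fin (n + 1) → ℝ) {t : ℝ}
    (ht : t ∈ knotInterval x) (hx : Monotone x) :
    ∃ i : Fin n, t ∈ Icc (x i.castSucc) (x i.succ) := by
  have key : ∀ j : Fin (n + 1), t ≤ x j →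
      t ≤ x 0 ∨ ∃ i : Fin n, t ∈ Icc (x i.castSucc) (x i.succ) := by
    intro j
    induction j using Fin.induction with
    | zero => exact fun h => Or.inl h
    | succ i ih =>
      intro h
      rcases le_total t (x i.castSucc) with h' | h'
      · exact ih h'
      · exact Or.inr ⟨i, h', h⟩
  rcases key _ ht.2 with h | h
  · refine ⟨⟨0, hn⟩, ht.1, h.trans (hx (Fin.zero_le _))⟩
  · exact h

theorem hasDerivWithinAt_iteratedDerivWithin {f : ℝ → ℝ} {K : Set ℝ} {m k : ℕ}
    (hf : ContDiffOn ℝ m f K) (hK : UniqueDiffOn ℝ K) (hk : k < m) {u : ℝ} (hu : u ∈ K) :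
    HasDerivWithinAt (iteratedDerivWithin k f K) (iteratedDerivWithin (k + 1) f K u) K u := by
  rw [iteratedDerivWithin_succ]
  exact (hf.differentiableOn_iteratedDerivWithin (by exact_mod_cast hk) hK u hu).hasDerivWithinAt

/-! ### Slope estimates at the knots -/

/-- If consecutive slopes `E₀, E, E₁` and the curvature `z` of an error function at the middle knot
satisfy the two one-sided relations, the middle slope being the largest, then it is small. -/
theorem slope_bound_interior {a b h M z E₀ E E₁ : ℝ} (ha : 0 < a) (hb : 0 < b) (hah : a ≤ h)
    (hbh : b ≤ h) (hM : 0 ≤ M) (h₀ : |E₀| ≤ |E|) (h₁ : |E₁| ≤ |E|)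
    (hl : |z * a - (2 * E₀ + 4 * E)| ≤ M * a ^ 3 / 12)
    (hr : |z * b + (4 * E + 2 * E₁)| ≤ M * b ^ 3 / 12) : |E| ≤ M * h ^ 3 / 24 := by
  -- Weights `a` and `b` cancel the curvature `z`.
  have hid : 4 * (a + b) * E = (z * b + (4 * E + 2 * E₁)) * a
      - (z * a - (2 * E₀ + 4 * E)) * b - 2 * E₁ * a - 2 * E₀ * b := by ring
  have h1 : 4 * (a + b) * |E| ≤ M * b ^ 3 / 12 * a + M * a ^ 3 / 12 * b
      + 2 * |E| * a + 2 * |E| * b := by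
    have : 4 * (a + b) * |E| = |4 * (a + b) * E| := by
      rw [abs_mul, abs_of_pos (by positivity : 0 < 4 * (a + b))]
    rw [this, hid]
    refine (abs_sub _ _).trans (add_le_add ((abs_sub _ _).trans (add_le_add
      ((abs_sub _ _).trans (add_le_add ?_ ?_)) ?_)) ?_)
    · rw [abs_mul, abs_of_pos ha]; gcongr
    · rw [abs_mul, abs_of_pos hb]; gcongr
    · rw [abs_mul, abs_mul, abs_of_pos ha, abs_two]; gcongr
    · rw [abs_mul, abs_mul, abs_of_pos hb, abs_two]; gcongr
  have h2 : a * b * (a ^ 2 + b ^ 2) ≤ (a + b) * h ^ 3 := by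
    have hh : 0 < h := ha.trans_le hah
    have e1 : a ^ 2 + b ^ 2 ≤ 2 * h ^ 2 := by nlinarith
    have e2 : 2 * (a * b) ≤ (a + b) * h := by nlinarith
    calc a * b * (a ^ 2 + b ^ 2) ≤ a * b * (2 * h ^ 2) := by gcongr
      _ = 2 * (a * b) * h ^ 2 := by ring
      _ ≤ (a + b) * h * h ^ 2 := by gcongr
      _ = _ := by ring
  have h3 : |E| * (2 * (a + b)) ≤ M * h ^ 3 / 24 * (2 * (a + b)) := by
    nlinarith [mul_le_mul_of_nonneg_left h2 hM]
  exact le_of_mul_le_mul_right h3 (by positivity)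

theorem slope_bound_end {b h M z r E E₁ : ℝ} (hb : 0 < b) (hbh : b ≤ h)
    (hM : 0 ≤ M) (h₁ : |E₁| ≤ |E|) (hz : |z| ≤ r)
    (hr : |z * b + (4 * E + 2 * E₁)| ≤ M * b ^ 3 / 12) :
    |E| ≤ M * h ^ 3 / 24 + r * h / 2 := by
  have hid : 4 * E = (z * b + (4 * E + 2 * E₁)) - z * b - 2 * E₁ := by ring
  have h1 : 4 * |E| ≤ M * b ^ 3 / 12 + r * b + 2 * |E| := by
    have : 4 * |E| = |4 * E| := by rw [abs_mul, abs_of_pos (by norm_num : (0 : ℝ) < 4)]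
    rw [this, hid]
    refine (abs_sub _ _).trans (add_le_add ((abs_sub _ _).trans (add_le_add hr ?_)) ?_)
    · rw [abs_mul, abs_of_pos hb]; gcongr
    · rw [abs_mul, abs_two]; gcongr
  have h2 : M * b ^ 3 ≤ M * h ^ 3 := by gcongr
  have h3 : r * b ≤ r * h := mul_le_mul_of_nonneg_left hbh ((abs_nonneg z).trans hz)
  linarith

section Spline

variable {n : ℕ} {x : Fin (n + 1) → ℝ} {f s : ℝ → ℝ}

theorem Icc_knots_subset (hx : Monotone x) (i : Fin n) :
    Icc (x i.castSucc) (x i.succ) ⊆ knotInterval x :=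
  Icc_subset_Icc (hx (Fin.zero_le _)) (hx (Fin.le_last _))

theorem uniqueDiffOn_knotInterval (hn : 1 ≤ n) (hx : StrictMono x) :
    UniqueDiffOn ℝ (knotInterval x) :=
  uniqueDiffOn_Icc (hx (by rw [Fin.lt_def]; simpa using Nat.lt_of_succ_le hn))

theorem sub_le_meshSize (x : Fin (n + 1) → ℝ) (i : Fin n) :
    x i.succ - x i.castSucc ≤ meshSize x :=
  le_ciSup (f := fun i : Fin n => x i.succ - x i.castSucc) (Set.finite_range _).bddAbove i

theorem abs_le_fourthDerivNorm (hn : 1 ≤ n) (hx : StrictMono x)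
    (hf : ContDiffOn ℝ 4 f (knotInterval x)) {u : ℝ} (hu : u ∈ knotInterval x) :
    |iteratedDerivWithin 4 f (knotInterval x) u| ≤ fourthDerivNorm x f := by
  have hc := hf.continuousOn_iteratedDerivWithin (m := 4) le_rfl (uniqueDiffOn_knotInterval hn hx)
  exact le_csSup (isCompact_Icc.image_of_continuousOn hc.abs).bddAbove (mem_image_of_mem _ hu)

/-- On each subinterval the error of a spline interpolant starts a chain of derivatives, whose first
two members are the global ones. -/
theorem exists_isDerivChain_error (hn : 1 ≤ n) (hx : StrictMono x)
    (hf : ContDiffOn ℝ 4 f (knotInterval x)) (hs : IsCubicSplineInterpolant x f s) (i : Fin n) :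
    ∃ g : ℕ → ℝ → ℝ, IsDerivChain (x i.castSucc) (x i.succ) g ∧
      (∀ k ≤ 2, ∀ u ∈ Icc (x i.castSucc) (x i.succ), g k u =
        iteratedDerivWithin k s (knotInterval x) u - iteratedDerivWithin k f (knotInterval x) u) ∧
      ∀ u ∈ Icc (x i.castSucc) (x i.succ), |g 4 u| ≤ fourthDerivNorm x f := by
  obtain ⟨P, hdeg, hP⟩ := hs.piecewise_cubic i
  have hK := uniqueDiffOn_knotInterval hn hx
  have hsub := Icc_knots_subset hx.monotone i
  have hJ : UniqueDiffOn ℝ (Icc (x i.castSucc) (x i.succ)) :=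
    uniqueDiffOn_Icc (hx Fin.castSucc_lt_succ)
  have hPd : ∀ k u, HasDerivAt (fun u => (Polynomial.derivative^[k] P).eval u)
      ((Polynomial.derivative^[k + 1] P).eval u) u := by
    intro k u
    rw [Function.iterate_succ_apply']
    exact Polynomial.hasDerivAt _ _
  -- Order 2 is the limit: `s'''` may jump at knots, so higher members of the chain come from the
  -- local cubic.
  have hS : ∀ k ≤ 2, ∀ u ∈ Icc (x i.castSucc) (x i.succ),
      iteratedDerivWithin k s (knotInterval x) u = (Polynomial.derivative^[k] P).eval u := by
    intro k
    induction k with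
    | zero => intro _ u hu; simpa using hP u hu
    | succ k ih =>
      intro hk u hu
      have h1 := (hasDerivWithinAt_iteratedDerivWithin (m := 2) hs.contDiffOn hK (by omega)
        (hsub hu) : HasDerivWithinAt (iteratedDerivWithin k s _) _ _ u).mono hsub
      have h2 := (hPd k u).hasDerivWithinAt (s := Icc (x i.castSucc) (x i.succ))
      exact (hJ u hu).eq_deriv _ h1
        (h2.congr (ih (by omega)) (ih (by omega) u hu))
  refine ⟨fun k u => (Polynomial.derivative^[k] P).eval u -
    iteratedDerivWithin k f (knotInterval x) u, ?_, ?_, ?_⟩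
  · intro k hk u hu
    exact (hPd k u).hasDerivWithinAt.sub
      ((hasDerivWithinAt_iteratedDerivWithin (m := 4) hf hK hk (hsub hu)).mono hsub)
  · intro k hk u hu
    simp only [hS k hk u hu]
  · intro u hu
    have h4 : Polynomial.derivative^[4] P = 0 :=
      Polynomial.iterate_derivative_eq_zero
        (lt_of_le_of_lt (Polynomial.natDegree_le_of_degree_le hdeg) (by norm_num))
    simpa only [h4, Polynomial.eval_zero, zero_sub, abs_neg] using
      abs_le_fourthDerivNorm hn hx hf (hsub hu)

/-- The slope error of the spline at the knots. -/
theorem IsApproxClampedNaturalSpline.slope_error {R : ℝ} (hn : 1 ≤ n) (hx : StrictMono x)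
    (hf : ContDiffOn ℝ 4 f (knotInterval x)) (hs : IsApproxClampedNaturalSpline R x f s)
    (i : Fin (n + 1)) :
    |iteratedDerivWithin 1 s (knotInterval x) (x i) -
      iteratedDerivWithin 1 f (knotInterval x) (x i)| ≤
      fourthDerivNorm x f * meshSize x ^ 3 / 24 +
        R * fourthDerivNorm x f * meshSize x ^ 2 * meshSize x / 2 := by
  obtain ⟨κ₀, κₙ, hκ₀, hκₙ, hsi, rfl, rfl⟩ := hs
  set K := knotInterval x with hKdef
  set M := fourthDerivNorm x f
  set h := meshSize x
  set r := R * M * h ^ 2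
  set E : Fin (n + 1) → ℝ := fun i =>
    iteratedDerivWithin 1 s K (x i) - iteratedDerivWithin 1 f K (x i) with hE
  set Z : Fin (n + 1) → ℝ := fun i =>
    iteratedDerivWithin 2 s K (x i) - iteratedDerivWithin 2 f K (x i) with hZ
  have hlt : ∀ j : Fin n, 0 < x j.succ - x j.castSucc :=
    fun j => sub_pos.2 (hx Fin.castSucc_lt_succ)
  have hM : 0 ≤ M := (abs_nonneg _).trans
    (abs_le_fourthDerivNorm hn hx hf (left_mem_Icc.2 (hx.monotone (Fin.zero_le _))))
  have hh : 0 ≤ h := (hlt ⟨0, hn⟩).le.trans (sub_le_meshSize x _)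
  -- No sign of `R` is assumed; the end condition supplies this one.
  have hr : 0 ≤ r := (abs_nonneg _).trans hκ₀
  have hLR : ∀ j : Fin n,
      |Z j.succ * (x j.succ - x j.castSucc) - (2 * E j.castSucc + 4 * E j.succ)| ≤
        M * (x j.succ - x j.castSucc) ^ 3 / 12 ∧
      |Z j.castSucc * (x j.succ - x j.castSucc) + (4 * E j.castSucc + 2 * E j.succ)| ≤
        M * (x j.succ - x j.castSucc) ^ 3 / 12 := by
    intro j
    obtain ⟨g, hg, hgk, hg4⟩ := exists_isDerivChain_error hn hx hf hsi j
    have hj : x j.castSucc < x j.succ := hx Fin.castSucc_lt_succ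
    have hl := left_mem_Icc.2 hj.le
    have hr := right_mem_Icc.2 hj.le
    have g0l : g 0 (x j.castSucc) = 0 := by
      simp [hgk 0 (by norm_num) _ hl, hsi.interpolates]
    have g0r : g 0 (x j.succ) = 0 := by
      simp [hgk 0 (by norm_num) _ hr, hsi.interpolates]
    have c1 := hg.second_deriv_right hj g0l g0r hg4
    have c2 := hg.second_deriv_left hj g0l g0r hg4
    rw [hgk 2 le_rfl _ hr, hgk 1 (by norm_num) _ hl, hgk 1 (by norm_num) _ hr] at c1
    rw [hgk 2 le_rfl _ hl, hgk 1 (by norm_num) _ hl, hgk 1 (by norm_num) _ hr] at c2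
    exact ⟨c1, c2⟩
  obtain ⟨m, hm⟩ := Finite.exists_max (fun i => |E i|)
  refine (hm i).trans ?_
  show |E m| ≤ _
  rcases Fin.eq_zero_or_eq_succ m with rfl | ⟨j, rfl⟩
  · exact slope_bound_end (hlt ⟨0, hn⟩) (sub_le_meshSize x _) hM (hm _) hκ₀ (hLR ⟨0, hn⟩).2
  · have hl := (hLR j).1
    rcases Fin.eq_castSucc_or_eq_last j.succ with ⟨k, hk⟩ | hk
    · have hr' := (hLR k).2
      rw [← hk] at hr'
      have := slope_bound_interior (hlt j) (b := x k.succ - x j.succ) (by rw [hk]; exact hlt k)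
        (sub_le_meshSize x _) (by rw [hk]; exact sub_le_meshSize x _) hM (hm _) (hm _) hl hr'
      have : 0 ≤ r * h / 2 := by positivity
      linarith
    -- The last knot is the first one reflected: slopes change sign, curvature does not.
    · have hZn : |-Z j.succ| ≤ r := by rw [abs_neg, hk]; exact hκₙ
      rw [← abs_neg (E j.succ)]
      refine slope_bound_end (E₁ := -E j.castSucc) (hlt j) (sub_le_meshSize x _) hM
        (by simpa using hm j.castSucc) (z := Z j.succ) (by simpa using hZn) ?_
      convert hl using 2
      ring

end Spline

theorem theorem1 (n : ℕ) (hn : 1 ≤ n) (x : Fin (n + 1) → ℝ) (hx : StrictMono x)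
    (f : ℝ → ℝ) (hf : ContDiffOn ℝ 4 f (knotInterval x)) (R : ℝ) (s : ℝ → ℝ)
    (hs : IsApproxClampedNaturalSpline R x f s) :
    ∀ t ∈ knotInterval x,
      |s t - f t| ≤ (5 / 384 + R / 8) * fourthDerivNorm x f * meshSize x ^ 4 := by
  intro t ht
  obtain ⟨i, hi⟩ := exists_mem_Icc_castSucc_succ hn x ht hx.monotone
  have hsl := hs.slope_error hn hx hf
  obtain ⟨_, _, _, _, hsi, _, _⟩ := hs
  obtain ⟨g, hg, hgk, hg4⟩ := exists_isDerivChain_error hn hx hf hsi i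
  have hlt : x i.castSucc < x i.succ := hx Fin.castSucc_lt_succ
  have hl := left_mem_Icc.2 hlt.le
  have hr := right_mem_Icc.2 hlt.le
  have hb := hg.abs_le (by simp [hgk 0 (by norm_num) _ hl, hsi.interpolates])
    (by simp [hgk 0 (by norm_num) _ hr, hsi.interpolates]) hg4
    ((congrArg _ (hgk 1 (by norm_num) _ hl)).trans_le (hsl _))
    ((congrArg _ (hgk 1 (by norm_num) _ hr)).trans_le (hsl _)) hi
  have h0 : g 0 t = s t - f t := by simp [hgk 0 (by norm_num) _ hi]
  rw [h0] at hb
  refine hb.trans ?_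
  have hM : 0 ≤ fourthDerivNorm x f := (abs_nonneg _).trans (hg4 t hi)
  -- Needed to enlarge the subinterval length to `h` in the slope term, as `R` may be negative.
  have hD := (abs_nonneg _).trans (hsl 0)
  have ha : 0 ≤ x i.succ - x i.castSucc := (sub_pos.2 hlt).le
  have hah := sub_le_meshSize x i
  calc _ ≤ fourthDerivNorm x f * meshSize x ^ 4 / 384 +
      (fourthDerivNorm x f * meshSize x ^ 3 / 24 +
        R * fourthDerivNorm x f * meshSize x ^ 2 * meshSize x / 2) * meshSize x / 4 := by gcongr
    _ = _ := by ring
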